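/- Let $(k,\sigma)$ be a $\sigma$-field, i.e. a field $k$ with a ring endomorphism $\sigma\colon k\to k$. A $k$-$\sigma$-algebra is a commutative $k$-algebra $R$ with a ring endomorphism $\sigma\colon R\to R$ extending $\sigma\colon k\to k$. An (affine) $\sigma$-variety over $k$ is a functor from $k$-$\sigma$-algebras to sets that is isomorphic to a functor $R\mapsto\{x\in R^n \mid f(x)=0\ \text{for all } f\in F\}$ for some $n\ge 1$ and some set $F$ of $\sigma$-polynomials in $n$ $\sigma$-variables over $k$. A $\sigma$-algebraic group over $k$ is a group object in the category of $\sigma$-varieties over $k$; a morphism of $\sigma$-algebraic groups is a natural transformation $\varphi\colon G\to H$ such that $\varphi_R\colon G(R)\to H(R)$ is a group homomorphism for every $k$-$\sigma$-algebra $R$. A $\sigma$-closed $\sigma$-subvariety of a $\sigma$-variety is the subfunctor on which some set of elements of its coordinate ring vanishes. A morphism is a $\sigma$-closed embedding if it induces an isomorphism of $\sigma$-varieties from its source onto a $\sigma$-closed $\sigma$-subvariety of its target. A morphism $\varphi\colon G\to H$ of $\sigma$-algebraic groups is a quotient map if $\varphi(G)=H$, where $\varphi(G)$ is the smallest $\sigma$-closed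 $\sigma$-subvariety of $H$ through which $\varphi$ factors. Then every morphism $\varphi\colon G\to H$ of $\sigma$-algebraic groups over $k$ factors as $\varphi=\iota\circ\pi$ with a $\sigma$-algebraic group $H_1$, a quotient map $\pi\colon G\to H_1$ and a $\sigma$-closed embedding $\iota\colon H_1\to H$ that are morphisms of $\sigma$-algebraic groups. Moreover, this factorization is unique up to unique isomorphism: if $\varphi=\iota_1\circ\pi_1=\iota_2\circ\pi_2$ are two such factorizations, through $H_1$ and $H_2$ respectively, then there exists a unique isomorphism $e\colon H_1\to H_2$ of $\sigma$-algebraic groups such that $e\circ\pi_1=\pi_2$ and $\iota_2\circ e=\iota_1$. -/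

import Mathlib

open CategoryTheory

universe u

section

variable {k : Type u} [Field k]

/-- An algebra over the difference field `(k, σ)`: a commutative `k`-algebra with a ring endomorphism
`shift` that extends the given endomorphism `σ` of `k`. -/
structure DiffAlg (σ : k →+* k) where
  carrier : Type u
  [commRing : CommRing carrier]
  [algebra : Algebra k carrier]
  shift : carrier →+* carrier
  shift_algebraMap : ∀ a : k, shift (algebraMap k carrier a) = algebraMap k carrier (σ a)

namespace DiffAlg

variable {σ : k →+* k}

instance : CoeSort (DiffAlg σ) (Type u) := ⟨DiffAlg.carrier⟩

attribute [instance] DiffAlg.commRing DiffAlg.algebra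

/-- Morphisms of difference algebras over `(k, σ)`: morphisms of `k`-algebras that commute with the
endomorphisms. -/
@[ext]
structure Hom (R S : DiffAlg σ) where
  toAlgHom : R →ₐ[k] S
  map_shift : ∀ r : R, toAlgHom (R.shift r) = S.shift (toAlgHom r)

instance : Category (DiffAlg σ) where
  Hom := Hom
  id R := ⟨AlgHom.id k R, fun _ => rfl⟩
  comp f g := ⟨g.toAlgHom.comp f.toAlgHom, fun r => by
    simp only [AlgHom.comp_apply, f.map_shift, g.map_shift]⟩

/-- The value of a difference polynomial at a tuple `x`. The difference polynomial ring in `n`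
difference variables is the polynomial ring in the variables `σ ^ i (y j)`, indexed by pairs
`(i, j)`, and `σ ^ i (y j)` is specialised to `σ ^ i (x j)`. -/
noncomputable def evalDiffPoly {n : ℕ} (R : DiffAlg σ) (x : Fin n → R)
    (f : MvPolynomial (ℕ × Fin n) k) : R :=
  MvPolynomial.aeval (fun p : ℕ × Fin n => R.shift^[p.1] (x p.2)) f

theorem map_evalDiffPoly {n : ℕ} {R S : DiffAlg σ} (ψ : R ⟶ S) (x : Fin n → R)
    (f : MvPolynomial (ℕ × Fin n) k) :
    ψ.toAlgHom (R.evalDiffPoly x f) = S.evalDiffPoly (fun j => ψ.toAlgHom (x j)) f := by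
  have h : ∀ (i : ℕ) (r : R), ψ.toAlgHom (R.shift^[i] r) = S.shift^[i] (ψ.toAlgHom r) := by
    intro i
    induction i with
    | zero => intro r; rfl
    | succ i ih =>
      intro r
      rw [Function.iterate_succ_apply, Function.iterate_succ_apply, ih, ψ.map_shift]
  unfold evalDiffPoly
  rw [← AlgHom.comp_apply, MvPolynomial.comp_aeval]
  simp only [h]

end DiffAlg

open DiffAlg

variable (σ : k →+* k)

/-- The functor `R ↦ 𝕍_R(F)` of solutions of a set `F` of difference polynomials in `n` variables. -/
noncomputable def solutionFunctor (n : ℕ) (F : Set (MvPolynomial (ℕ × Fin n) k)) :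
    DiffAlg σ ⥤ Type u where
  obj R := {x : Fin n → R // ∀ f ∈ F, R.evalDiffPoly x f = 0}
  map {R S} ψ := TypeCat.ofHom fun x => ⟨fun j => ψ.toAlgHom (x.1 j), fun f hf => by
    rw [← map_evalDiffPoly, x.2 f hf, map_zero]⟩

/-- The functor sending a difference algebra to its underlying set (the affine line). -/
def affineLine : DiffAlg σ ⥤ Type u where
  obj R := R
  map ψ := TypeCat.ofHom fun r => ψ.toAlgHom r

variable {σ}

/-- The value at a point `x ∈ X(R)` of a natural transformation from `X` to the affine line. -/
def evalFun {X : DiffAlg σ ⥤ Type u} (f : X ⟶ affineLine σ) {R : DiffAlg σ} (x : X.obj R) : R :=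
  f.app R x

/-- An (affine) difference variety: a functor isomorphic to the functor of solutions of a set of
difference polynomials in finitely many (at least one) difference variables. -/
def IsDiffVariety (X : DiffAlg σ ⥤ Type u) : Prop :=
  ∃ (n : ℕ) (F : Set (MvPolynomial (ℕ × Fin n) k)), 1 ≤ n ∧ Nonempty (X ≅ solutionFunctor σ n F)

/-- The subfunctor `Y` of `X` is a difference closed subvariety: it is the locus where a set of
elements of the coordinate ring of `X` vanishes. If `X` is represented by `k{X}`, then by the Yoneda
lemma the elements of `k{X}` are the same as the natural transformations from `X` to the affine
line, an element `f` acting on `X(R) = Hom(k{X}, R)` by `ψ ↦ ψ f`. -/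
def IsDiffClosed {X : DiffAlg σ ⥤ Type u} (Y : Subfunctor X) : Prop :=
  ∃ F : Set (X ⟶ affineLine σ), ∀ (R : DiffAlg σ) (x : X.obj R),
    x ∈ Y.obj R ↔ ∀ f ∈ F, evalFun f x = 0

/-- The image `φ(X)` of a morphism `φ : X ⟶ Y`: the smallest difference closed subvariety of `Y`
through which `φ` factors. -/
def diffImage {X Y : DiffAlg σ ⥤ Type u} (φ : X ⟶ Y) : Subfunctor Y :=
  sInf {Z | IsDiffClosed Z ∧ Subfunctor.range φ ≤ Z}

theorem diffImage_isLeast {X Y : DiffAlg σ ⥤ Type u} (φ : X ⟶ Y) :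
    IsLeast {Z | IsDiffClosed Z ∧ Subfunctor.range φ ≤ Z} (diffImage φ) := by
  refine ⟨⟨⟨{f | ∃ Z : Subfunctor Y, (IsDiffClosed Z ∧ Subfunctor.range φ ≤ Z) ∧
    ∀ (R : DiffAlg σ), ∀ x ∈ Z.obj R, evalFun f x = 0}, fun R x => ⟨?_, ?_⟩⟩, ?_⟩, fun Z hZ => sInf_le hZ⟩
  · rintro hx f ⟨Z, hZ, hf⟩
    exact hf R x (hx _ ⟨Z, hZ, rfl⟩)
  · rintro h _ ⟨Z, hZ, rfl⟩
    obtain ⟨F, hF⟩ := hZ.1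
    exact (hF R x).2 fun f hf => h f ⟨Z, hZ, fun S y hy => (hF S y).1 hy f hf⟩
  · exact le_sInf fun Z hZ => hZ.2

/-- A morphism is a difference closed embedding if it induces an isomorphism between its source and a
difference closed subvariety of its target. -/
def IsDiffClosedEmbedding {X Y : DiffAlg σ ⥤ Type u} (φ : X ⟶ Y) : Prop :=
  ∃ Z : Subfunctor Y, IsDiffClosed Z ∧ ∃ e : X ≅ Z.toFunctor, e.hom ≫ Z.ι = φ

variable (σ)

/-- A group-valued functor on difference algebras whose underlying set-valued functor is a difference
variety. -/
def isDiffAlgGroup : ObjectProperty (DiffAlg σ ⥤ GrpCat.{u}) :=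
  fun G => IsDiffVariety (G ⋙ forget GrpCat.{u})

/-- The category of (affine) difference algebraic groups over `(k, σ)`. An object is a difference
variety `G` together with a group structure on each `G(R)`, functorial in `R` (that is, a group
object in difference varieties, whose products are formed pointwise), and a morphism is a natural
transformation consisting of group homomorphisms. -/
abbrev DiffAlgGroup := (isDiffAlgGroup σ).FullSubcategory

variable {σ}

namespace DiffAlgGroup

/-- The underlying difference variety. -/
abbrev toVariety (G : DiffAlgGroup σ) : DiffAlg σ ⥤ Type u :=
  G.obj ⋙ forget GrpCat.{u}

/-- The underlying morphism of difference varieties. -/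
abbrev toVarietyHom {G H : DiffAlgGroup σ} (φ : G ⟶ H) : G.toVariety ⟶ H.toVariety :=
  Functor.whiskerRight φ.hom (forget GrpCat.{u})

/-- A morphism of difference algebraic groups is a closed embedding if it is one as a morphism of
difference varieties. -/
def IsClosedEmbedding {G H : DiffAlgGroup σ} (φ : G ⟶ H) : Prop :=
  IsDiffClosedEmbedding (toVarietyHom φ)

/-- A morphism `φ : G ⟶ H` of difference algebraic groups is a quotient map if `φ(G) = H`. -/
def IsQuotientMap {G H : DiffAlgGroup σ} (φ : G ⟶ H) : Prop :=
  diffImage (toVarietyHom φ) = ⊤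

end DiffAlgGroup

end

section

variable {k : Type u} [Field k] {σ : k →+* k}

/-! ### Ranges and tensor products of difference algebras -/

namespace DiffAlg

/-! The factorization goes through the image φ(G); the point is that φ(G) is a subgroup. Let `B` be
the coordinate ring of `G` and `C` the range of the dual map k{H} → `B`. Then φ(G) has a generic
point `c` over `C`: every point of φ(G) is a specialization of `c`, and over `B` ⊇ `C` it becomes a
value φ(b) (`exists_generic_diffImage`). Membership in a closed subvariety descends along injections
(`IsDiffClosed.mem_of_injective`), so it suffices to multiply two independent copies of `c` over `C
⊗ C`. This embeds in `B ⊗ B`, as `k` is a field, and there the product is a value of φ. Specializing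
gives all products; inverses are handled over `C` itself.

For uniqueness, the range of ι in any factorization must be φ(G) (`range_eq_diffImage`). Closed
embeddings are pointwise injective, so two with the same range factor uniquely through each other.
-/

theorem hom_ext {R S : DiffAlg σ} {f g : R ⟶ S} (h : ∀ r, f.toAlgHom r = g.toAlgHom r) : f = g :=
  Hom.ext (AlgHom.ext h)

/-- The range of a morphism of difference algebras. -/
def range {R S : DiffAlg σ} (f : R ⟶ S) : DiffAlg σ where
  carrier := f.toAlgHom.range
  shift := (S.shift.comp f.toAlgHom.range.val.toRingHom).codRestrict f.toAlgHom.range (by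
    rintro ⟨_, r, rfl⟩
    exact ⟨R.shift r, f.map_shift r⟩)
  shift_algebraMap a := Subtype.ext (S.shift_algebraMap a)

/-- The surjection of a difference algebra onto the range of a morphism. -/
def toRange {R S : DiffAlg σ} (f : R ⟶ S) : R ⟶ range f where
  toAlgHom := f.toAlgHom.rangeRestrict
  map_shift r := Subtype.ext (f.map_shift r)

/-- The inclusion of the range of a morphism of difference algebras. -/
def rangeIncl {R S : DiffAlg σ} (f : R ⟶ S) : range f ⟶ S where
  toAlgHom := f.toAlgHom.range.val
  map_shift _ := rfl

theorem toRange_rangeIncl {R S : DiffAlg σ} (f : R ⟶ S) : toRange f ≫ rangeIncl f = f := rfl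

theorem toRange_surjective {R S : DiffAlg σ} (f : R ⟶ S) :
    Function.Surjective (toRange f).toAlgHom := f.toAlgHom.rangeRestrict_surjective

theorem rangeIncl_injective {R S : DiffAlg σ} (f : R ⟶ S) :
    Function.Injective (rangeIncl f).toAlgHom := Subtype.val_injective

/-- A morphism that kills the kernel of a surjective morphism factors through it. -/
theorem exists_factor {R S T : DiffAlg σ} (p : R ⟶ S) (hp : Function.Surjective p.toAlgHom)
    (f : R ⟶ T) (hf : ∀ r, p.toAlgHom r = 0 → f.toAlgHom r = 0) : ∃ g : S ⟶ T, p ≫ g = f := by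
  have hg : ∀ r, AlgHom.liftOfSurjective p.toAlgHom hp f.toAlgHom hf (p.toAlgHom r) = f.toAlgHom r :=
    fun r => AlgHom.liftOfSurjective_apply ..
  refine ⟨⟨AlgHom.liftOfSurjective p.toAlgHom hp f.toAlgHom hf, fun s => ?_⟩, hom_ext hg⟩
  obtain ⟨r, rfl⟩ := hp s
  rw [← p.map_shift, hg, hg, f.map_shift]

open scoped TensorProduct

/-- The tensor product of two difference algebras. -/
noncomputable def tensor (R S : DiffAlg σ) : DiffAlg σ where
  carrier := R ⊗[k] S
  shift := Algebra.TensorProduct.mapRingHom σ R.shift S.shift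
    (RingHom.ext R.shift_algebraMap) (RingHom.ext S.shift_algebraMap)
  shift_algebraMap a := by
    rw [Algebra.TensorProduct.algebraMap_apply, Algebra.TensorProduct.mapRingHom_tmul,
      R.shift_algebraMap, map_one, Algebra.TensorProduct.algebraMap_apply]

theorem tensor_shift_tmul (R S : DiffAlg σ) (r : R) (s : S) :
    (tensor R S).shift (r ⊗ₜ[k] s : R ⊗[k] S) = (R.shift r ⊗ₜ[k] S.shift s : R ⊗[k] S) :=
  Algebra.TensorProduct.mapRingHom_tmul (HS := RingHom.ext R.shift_algebraMap)
    (HT := RingHom.ext S.shift_algebraMap) ..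

/-- An algebra morphism out of a tensor product commutes with the endomorphisms if it does so on
pure tensors. -/
noncomputable def tensorHomMk {R S T : DiffAlg σ} (f : R ⊗[k] S →ₐ[k] T)
    (hf : ∀ (r : R) (s : S), f (R.shift r ⊗ₜ S.shift s) = T.shift (f (r ⊗ₜ s))) :
    tensor R S ⟶ T where
  toAlgHom := f
  map_shift x := by
    refine TensorProduct.induction_on (motive := fun x =>
      f ((tensor R S).shift x : R ⊗[k] S) = T.shift (f x)) x ?_ (fun r s => ?_) fun x y hx hy => ?_
    · rw [map_zero, map_zero]
      exact (congrArg f (map_zero (tensor R S).shift)).trans (map_zero f)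
    · exact (congrArg f (tensor_shift_tmul R S r s)).trans (hf r s)
    · rw [map_add, map_add, ← hx, ← hy]
      exact (congrArg f (map_add (tensor R S).shift x y)).trans (map_add f _ _)

/-- The inclusion of the left factor into the tensor product. -/
noncomputable def tensorInl (R S : DiffAlg σ) : R ⟶ tensor R S where
  toAlgHom := Algebra.TensorProduct.includeLeft
  map_shift r := by
    refine .trans ?_ (tensor_shift_tmul R S r 1).symm
    rw [map_one]
    rfl

/-- The inclusion of the right factor into the tensor product. -/
noncomputable def tensorInr (R S : DiffAlg σ) : S ⟶ tensor R S where
  toAlgHom := Algebra.TensorProduct.includeRight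
  map_shift s := by
    refine .trans ?_ (tensor_shift_tmul R S 1 s).symm
    rw [map_one]
    rfl

/-- The morphism out of the tensor product given by morphisms out of both factors. -/
noncomputable def tensorLift {R S T : DiffAlg σ} (f : R ⟶ T) (g : S ⟶ T) : tensor R S ⟶ T :=
  tensorHomMk (Algebra.TensorProduct.lift f.toAlgHom g.toAlgHom fun _ _ => .all _ _) fun r s => by
    rw [Algebra.TensorProduct.lift_tmul, Algebra.TensorProduct.lift_tmul, map_mul, f.map_shift,
      g.map_shift]

/-- The tensor product of two morphisms. -/
noncomputable def tensorMap {R S R' S' : DiffAlg σ} (f : R ⟶ R') (g : S ⟶ S') :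
    tensor R S ⟶ tensor R' S' :=
  tensorHomMk (T := tensor R' S') (Algebra.TensorProduct.map f.toAlgHom g.toAlgHom) fun r s => by
    refine .trans ?_ (tensor_shift_tmul R' S' (f.toAlgHom r) (g.toAlgHom s)).symm
    rw [← f.map_shift, ← g.map_shift]
    rfl

theorem tensorInl_lift {R S T : DiffAlg σ} (f : R ⟶ T) (g : S ⟶ T) :
    tensorInl R S ≫ tensorLift f g = f :=
  Hom.ext (Algebra.TensorProduct.lift_comp_includeLeft (hfg := fun _ _ => .all _ _) ..)

theorem tensorInr_lift {R S T : DiffAlg σ} (f : R ⟶ T) (g : S ⟶ T) :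
    tensorInr R S ≫ tensorLift f g = g :=
  Hom.ext (Algebra.TensorProduct.lift_comp_includeRight (hfg := fun _ _ => .all _ _) ..)

theorem tensorInl_map {R S R' S' : DiffAlg σ} (f : R ⟶ R') (g : S ⟶ S') :
    tensorInl R S ≫ tensorMap f g = f ≫ tensorInl R' S' :=
  Hom.ext (Algebra.TensorProduct.map_comp_includeLeft ..)

theorem tensorInr_map {R S R' S' : DiffAlg σ} (f : R ⟶ R') (g : S ⟶ S') :
    tensorInr R S ≫ tensorMap f g = g ≫ tensorInr R' S' :=
  Hom.ext (Algebra.TensorProduct.map_comp_includeRight ..)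

/-- Over a field every module is flat. -/
theorem tensorMap_injective {R S R' S' : DiffAlg σ} (f : R ⟶ R') (g : S ⟶ S')
    (hf : Function.Injective f.toAlgHom) (hg : Function.Injective g.toAlgHom) :
    Function.Injective (tensorMap f g).toAlgHom :=
  TensorProduct.map_injective_of_flat_flat f.toAlgHom.toLinearMap g.toAlgHom.toLinearMap hf hg

/-! ### Difference polynomials and coordinate rings -/

/-- The endomorphism of the difference polynomial ring. -/
noncomputable def polyShift (σ : k →+* k) (n : ℕ) :
    MvPolynomial (ℕ × Fin n) k →+* MvPolynomial (ℕ × Fin n) k :=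
  MvPolynomial.eval₂Hom (MvPolynomial.C.comp σ) fun p => MvPolynomial.X (p.1 + 1, p.2)

theorem evalDiffPoly_polyShift {n : ℕ} (R : DiffAlg σ) (x : Fin n → R)
    (f : MvPolynomial (ℕ × Fin n) k) :
    R.evalDiffPoly x (polyShift σ n f) = R.shift (R.evalDiffPoly x f) := by
  unfold evalDiffPoly
  induction f using MvPolynomial.induction_on with
  | C a => simp [polyShift, R.shift_algebraMap]
  | add p q hp hq => simp only [map_add, hp, hq]
  | mul_X p i hp =>
    rw [map_mul, map_mul, hp, map_mul, map_mul]
    simp [polyShift, Function.iterate_succ_apply']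

theorem polyShift_iterate_X (n i : ℕ) (j : Fin n) :
    (polyShift σ n)^[i] (MvPolynomial.X (0, j)) = MvPolynomial.X (i, j) := by
  induction i with
  | zero => rfl
  | succ i ih => rw [Function.iterate_succ_apply', ih]; simp [polyShift]

end DiffAlg

open DiffAlg

theorem evalFun_map {X : DiffAlg σ ⥤ Type u} (f : X ⟶ affineLine σ) {R S : DiffAlg σ} (ψ : R ⟶ S)
    (x : X.obj R) : evalFun f (X.map ψ x) = ψ.toAlgHom (evalFun f x) :=
  NatTrans.naturality_apply f ψ x

theorem evalFun_comp {X Y : DiffAlg σ ⥤ Type u} (φ : X ⟶ Y) (f : Y ⟶ affineLine σ) {R : DiffAlg σ}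
    (x : X.obj R) : evalFun (φ ≫ f) x = evalFun f (φ.app R x) := rfl

variable (σ) in
/-- The difference polynomials that vanish on all solutions of `F`. -/
def vanishingIdeal (n : ℕ) (F : Set (MvPolynomial (ℕ × Fin n) k)) :
    Ideal (MvPolynomial (ℕ × Fin n) k) where
  -- With this choice, rather than the difference ideal generated by `F`, stability under the shift
  -- and descent of evaluation to the quotient are immediate.
  carrier := {p | ∀ (R : DiffAlg σ) (x : (solutionFunctor σ n F).obj R), R.evalDiffPoly x.1 p = 0}
  add_mem' hp hq R x := by
    have h := hp R x
    have h' := hq R x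
    unfold evalDiffPoly at *
    rw [map_add, h, h', add_zero]
  zero_mem' R x := map_zero _
  smul_mem' c p hp R x := by
    have h := hp R x
    unfold evalDiffPoly at *
    rw [smul_eq_mul, map_mul, h, mul_zero]

variable (σ) in
/-- The coordinate ring of the solution functor. -/
noncomputable def coordinateRing (n : ℕ) (F : Set (MvPolynomial (ℕ × Fin n) k)) : DiffAlg σ where
  carrier := MvPolynomial (ℕ × Fin n) k ⧸ vanishingIdeal σ n F
  shift := Ideal.quotientMap _ (polyShift σ n) fun p hp R x => by
    rw [evalDiffPoly_polyShift, hp R x, map_zero]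
  shift_algebraMap a := by
    refine (Ideal.quotientMap_mk (I := vanishingIdeal σ n F) (f := polyShift σ n)
      (x := MvPolynomial.C a)).trans (congrArg (Ideal.Quotient.mk _) ?_)
    simp [polyShift]

namespace coordinateRing

variable {n : ℕ} {F : Set (MvPolynomial (ℕ × Fin n) k)}

/-- The class of a difference polynomial in the coordinate ring. -/
noncomputable def mk : MvPolynomial (ℕ × Fin n) k →ₐ[k] coordinateRing σ n F :=
  Ideal.Quotient.mkₐ k (vanishingIdeal σ n F)

theorem mk_surjective : Function.Surjective (mk (σ := σ) (F := F)) :=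
  Ideal.Quotient.mk_surjective

theorem mk_eq_zero {p : MvPolynomial (ℕ × Fin n) k} :
    mk (σ := σ) (F := F) p = 0 ↔ p ∈ vanishingIdeal σ n F :=
  Ideal.Quotient.eq_zero_iff_mem

theorem shift_mk (p : MvPolynomial (ℕ × Fin n) k) :
    (coordinateRing σ n F).shift (mk p) = mk (polyShift σ n p) :=
  Ideal.quotientMap_mk (H := fun p hp R x => by
    rw [evalDiffPoly_polyShift, hp R x, map_zero])

/-- Both sides are algebra maps in `p` that agree on variables, since the i-th shift of `X (0, j)`
is `X (i, j)`. -/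
theorem evalDiffPoly_mk_X (p : MvPolynomial (ℕ × Fin n) k) :
    (coordinateRing σ n F).evalDiffPoly (fun j => mk (.X (0, j))) p = mk p := by
  have h : ∀ i q, (coordinateRing σ n F).shift^[i] (mk q) = mk ((polyShift σ n)^[i] q) := by
    intro i
    induction i with
    | zero => intro q; rfl
    | succ i ih => intro q; rw [Function.iterate_succ_apply, shift_mk, ih]; rfl
  unfold evalDiffPoly
  refine DFunLike.congr_fun (f := MvPolynomial.aeval _) (g := mk (σ := σ) (F := F))
    (MvPolynomial.algHom_ext fun i => ?_) p
  rw [MvPolynomial.aeval_X, h, polyShift_iterate_X]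

/-- The morphism out of the coordinate ring given by evaluation at a solution. -/
noncomputable def eval {R : DiffAlg σ} (x : (solutionFunctor σ n F).obj R) :
    coordinateRing σ n F ⟶ R where
  toAlgHom := Ideal.Quotient.liftₐ (vanishingIdeal σ n F)
    (MvPolynomial.aeval fun p : ℕ × Fin n => R.shift^[p.1] (x.1 p.2)) fun _ hp => hp R x
  map_shift r := by
    obtain ⟨p, rfl⟩ := mk_surjective r
    rw [shift_mk]
    exact evalDiffPoly_polyShift R x.1 p

theorem eval_mk {R : DiffAlg σ} (x : (solutionFunctor σ n F).obj R)
    (p : MvPolynomial (ℕ × Fin n) k) : (eval x).toAlgHom (mk p) = R.evalDiffPoly x.1 p := rfl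

variable (σ n F) in
/-- The generic solution. -/
noncomputable def generic : (solutionFunctor σ n F).obj (coordinateRing σ n F) :=
  ⟨fun j => mk (.X (0, j)), fun f hf => by
    rw [evalDiffPoly_mk_X, mk_eq_zero]
    exact fun R x => x.2 f hf⟩

variable (σ n F) in
/-- The coordinate ring represents the solution functor. -/
noncomputable def corepresentableBy :
    (solutionFunctor σ n F).CorepresentableBy (coordinateRing σ n F) where
  homEquiv {R} :=
    { toFun ψ := (solutionFunctor σ n F).map ψ (generic σ n F)
      invFun x := eval x
      left_inv ψ := hom_ext fun r => by
        obtain ⟨p, rfl⟩ := mk_surjective r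
        rw [eval_mk, ← evalDiffPoly_mk_X, map_evalDiffPoly]
        rfl
      right_inv x := Subtype.ext (funext fun j => by
        change (eval x).toAlgHom (mk (.X (0, j))) = _
        rw [eval_mk]
        simp [evalDiffPoly]) }
  homEquiv_comp g f := by
    change (solutionFunctor σ n F).map (f ≫ g) _ = _
    rw [Functor.map_comp]
    rfl

end coordinateRing

/-- Every function on a solution functor is given by a difference polynomial. -/
theorem exists_evalFun_eq_evalDiffPoly {n : ℕ} {F : Set (MvPolynomial (ℕ × Fin n) k)}
    (f : solutionFunctor σ n F ⟶ affineLine σ) : ∃ p : MvPolynomial (ℕ × Fin n) k,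
      ∀ (R : DiffAlg σ) (x : (solutionFunctor σ n F).obj R), evalFun f x = R.evalDiffPoly x.1 p := by
  -- Yoneda: `f` is determined by its value at the generic solution.
  obtain ⟨p, hp⟩ := coordinateRing.mk_surjective (evalFun f (coordinateRing.generic σ n F))
  refine ⟨p, fun R x => ?_⟩
  rw [← coordinateRing.eval_mk, hp, ← evalFun_map]
  exact congrArg _ ((coordinateRing.corepresentableBy σ n F).homEquiv.right_inv x).symm

/-! ### Closed subvarieties and images -/

theorem IsDiffVariety.exists_corepresentableBy {X : DiffAlg σ ⥤ Type u} (hX : IsDiffVariety X) :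
    ∃ A : DiffAlg σ, Nonempty (X.CorepresentableBy A) := by
  obtain ⟨n, F, -, ⟨e⟩⟩ := hX
  exact ⟨_, ⟨(coordinateRing.corepresentableBy σ n F).ofIso e.symm⟩⟩

/-- The functions cutting out `Y` are transported along `e` to difference polynomials and adjoined
to `F`. -/
theorem IsDiffVariety.toFunctor {X : DiffAlg σ ⥤ Type u} (hX : IsDiffVariety X) {Y : Subfunctor X}
    (hY : IsDiffClosed Y) : IsDiffVariety Y.toFunctor := by
  obtain ⟨n, F, hn, ⟨e⟩⟩ := hX
  obtain ⟨E, hE⟩ := hY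
  choose p hp using fun f : X ⟶ affineLine σ => exists_evalFun_eq_evalDiffPoly (e.inv ≫ f)
  have hp' : ∀ (f : X ⟶ affineLine σ) (R : DiffAlg σ) (x : X.obj R),
      R.evalDiffPoly (e.hom.app R x).1 (p f) = evalFun f x := fun f R x => by
    rw [← hp, evalFun_comp, Iso.hom_inv_id_app_apply]
  let incl {R : DiffAlg σ} (y : (solutionFunctor σ n (F ∪ p '' E)).obj R) :
      (solutionFunctor σ n F).obj R := ⟨y.1, fun f hf => y.2 f (.inl hf)⟩
  have hincl : ∀ (R : DiffAlg σ) (y : (solutionFunctor σ n (F ∪ p '' E)).obj R),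
      e.hom.app R (e.inv.app R (incl y)) = incl y := fun R y => Iso.inv_hom_id_app_apply e R _
  refine ⟨n, F ∪ p '' E, hn, ⟨NatIso.ofComponents (fun R => Equiv.toIso
    { toFun := fun x => ⟨(e.hom.app R x.1).1, ?_⟩
      invFun := fun y => ⟨e.inv.app R (incl y), (hE R _).2 fun f hf => ?_⟩
      left_inv := fun x => Subtype.ext (Iso.hom_inv_id_app_apply e R x.1)
      right_inv := fun y => Subtype.ext (congrArg Subtype.val (hincl R y) :) }) ?_⟩⟩
  · rintro q (hq | ⟨f, hf, rfl⟩)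
    · exact (e.hom.app R x.1).2 q hq
    · rw [hp', (hE R x.1).1 x.2 f hf]
  · rw [← hp', hincl]
    exact y.2 _ (.inr ⟨f, hf, rfl⟩)
  · intro R S ψ
    ext x
    have h := congrArg Subtype.val (NatTrans.naturality_apply e.hom ψ x.1)
    exact Subtype.ext h

/-- Membership in a closed subvariety can be tested after an injective base change. -/
theorem IsDiffClosed.mem_of_injective {X : DiffAlg σ ⥤ Type u} {Y : Subfunctor X}
    (hY : IsDiffClosed Y) {R S : DiffAlg σ} (j : R ⟶ S) (hj : Function.Injective j.toAlgHom)
    {x : X.obj R} (hx : X.map j x ∈ Y.obj S) : x ∈ Y.obj R := by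
  obtain ⟨F, hF⟩ := hY
  refine (hF R x).2 fun f hf => hj ?_
  rw [← evalFun_map, (hF S _).1 hx f hf, map_zero]

theorem IsDiffClosed.preimage {X Y : DiffAlg σ ⥤ Type u} {Z : Subfunctor Y} (hZ : IsDiffClosed Z)
    (φ : X ⟶ Y) : IsDiffClosed (Z.preimage φ) := by
  obtain ⟨F, hF⟩ := hZ
  refine ⟨(φ ≫ ·) '' F, fun R x => ?_⟩
  rw [Set.forall_mem_image]
  exact hF R (φ.app R x)

theorem isDiffClosed_diffImage {X Y : DiffAlg σ ⥤ Type u} (φ : X ⟶ Y) :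
    IsDiffClosed (diffImage φ) := (diffImage_isLeast φ).1.1

theorem app_mem_diffImage {X Y : DiffAlg σ ⥤ Type u} (φ : X ⟶ Y) {R : DiffAlg σ} (x : X.obj R) :
    φ.app R x ∈ (diffImage φ).obj R := (diffImage_isLeast φ).1.2 R ⟨x, rfl⟩

theorem diffImage_le {X Y : DiffAlg σ ⥤ Type u} {φ : X ⟶ Y} {Z : Subfunctor Y}
    (hZ : IsDiffClosed Z) (h : Subfunctor.range φ ≤ Z) : diffImage φ ≤ Z :=
  (diffImage_isLeast φ).2 ⟨hZ, h⟩

/-- The zero locus of `f` is closed and contains the range of `φ`, hence the image by minimality. -/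
theorem evalFun_eq_zero_of_mem_diffImage {X Y : DiffAlg σ ⥤ Type u} {φ : X ⟶ Y}
    {f : Y ⟶ affineLine σ} (hf : ∀ (R : DiffAlg σ) (x : X.obj R), evalFun f (φ.app R x) = 0)
    {R : DiffAlg σ} {y : Y.obj R} (hy : y ∈ (diffImage φ).obj R) : evalFun f y = 0 := by
  let Z : Subfunctor Y :=
    { obj S := {y | evalFun f y = 0}
      map ψ y hy := by
        change evalFun f (Y.map ψ y) = 0
        rw [evalFun_map, Set.mem_ofPred.1 hy, map_zero] }
  refine diffImage_le (Z := Z) ⟨{f}, fun S y => ?_⟩ ?_ R hy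
  · exact ⟨fun h f hf => hf ▸ h, fun h => h f rfl⟩
  · rintro S _ ⟨x, rfl⟩
    exact hf S x

/-- The image of a morphism of difference varieties has a generic point, which becomes a value of
the morphism after an injective base change. -/
theorem exists_generic_diffImage {X Y : DiffAlg σ ⥤ Type u} (hX : IsDiffVariety X)
    (hY : IsDiffVariety Y) (φ : X ⟶ Y) : ∃ (C B : DiffAlg σ) (j : C ⟶ B) (c : Y.obj C) (b : X.obj B),
      Function.Injective j.toAlgHom ∧ Y.map j c = φ.app B b ∧
      ∀ (R : DiffAlg σ) (y : Y.obj R), y ∈ (diffImage φ).obj R → ∃ ψ : C ⟶ R, Y.map ψ c = y := by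
  obtain ⟨B, ⟨hB⟩⟩ := hX.exists_corepresentableBy
  obtain ⟨A, ⟨hA⟩⟩ := hY.exists_corepresentableBy
  let b : X.obj B := hB.homEquiv (𝟙 B)
  let α : A ⟶ B := hA.homEquiv.symm (φ.app B b)
  refine ⟨range α, B, rangeIncl α, hA.homEquiv (toRange α), b, rangeIncl_injective α, ?_,
    fun R y hy => ?_⟩
  · rw [← hA.homEquiv_comp, toRange_rangeIncl]
    exact hA.homEquiv.apply_symm_apply _
  · suffices h : ∀ a, (toRange α).toAlgHom a = 0 → (hA.homEquiv.symm y).toAlgHom a = 0 by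
      obtain ⟨ψ, hψ⟩ := exists_factor (toRange α) (toRange_surjective α) _ h
      exact ⟨ψ, by rw [← hA.homEquiv_comp, hψ, Equiv.apply_symm_apply]⟩
    intro a ha
    -- The kernel element `a` as a function on `Y`. It vanishes at `φ(b)`, hence at all values of
    -- `φ`, because every point of `X` is a specialization of `b`.
    let f : Y ⟶ affineLine σ :=
      { app S := TypeCat.ofHom fun z => (hA.homEquiv.symm z).toAlgHom a
        naturality S T ψ := by
          ext z
          change (hA.homEquiv.symm (Y.map ψ z)).toAlgHom a = ψ.toAlgHom _
          rw [← hA.homEquiv_symm_comp]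
          rfl }
    refine evalFun_eq_zero_of_mem_diffImage (f := f) (fun S x => ?_) hy
    have hx : φ.app S x = Y.map (hB.homEquiv.symm x) (φ.app B b) := by
      rw [← NatTrans.naturality_apply, ← hB.homEquiv_comp, Category.id_comp,
        Equiv.apply_symm_apply]
    have hb : evalFun f (φ.app B b) = 0 := congrArg Subtype.val ha
    rw [hx, evalFun_map, hb, map_zero]

/-! ### The image as a difference algebraic group -/

namespace DiffAlgGroup

/-- The image of a morphism of difference algebraic groups, as a family of subgroups. -/
def imageSubgroup {G H : DiffAlgGroup σ} (φ : G ⟶ H) (R : DiffAlg σ) : Subgroup (H.obj.obj R) where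
  carrier := (diffImage (toVarietyHom φ)).obj R
  one_mem' := by
    have h := app_mem_diffImage (toVarietyHom φ) (R := R) (1 : G.obj.obj R)
    rwa [show (toVarietyHom φ).app R (1 : G.obj.obj R) = (1 : H.obj.obj R) from
      map_one (φ.hom.app R).hom] at h
  mul_mem' {x y} hx hy := by
    obtain ⟨C, B, j, c, b, hj, hc, hC⟩ :=
      exists_generic_diffImage G.property H.property (toVarietyHom φ)
    obtain ⟨ψ, rfl⟩ := hC R x hx
    obtain ⟨χ, rfl⟩ := hC R y hy
    -- The product of two independent generic points; over `tensor B B` it becomes the value of `φ`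
    -- at `s`.
    let t : H.obj.obj (tensor C C) := H.obj.map (tensorInl C C) c * H.obj.map (tensorInr C C) c
    have ht : t ∈ (diffImage (toVarietyHom φ)).obj (tensor C C) := by
      refine (isDiffClosed_diffImage _).mem_of_injective (tensorMap j j)
        (tensorMap_injective j j hj hj) ?_
      let s : G.obj.obj (tensor B B) := G.obj.map (tensorInl B B) b * G.obj.map (tensorInr B B) b
      have hs : (toVarietyHom φ).app _ s = H.toVariety.map (tensorMap j j) t := by
        have hn : ∀ i : B ⟶ tensor B B, φ.hom.app _ (G.obj.map i b) = H.obj.map (j ≫ i) c :=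
          fun i => by
            rw [NatTrans.naturality_apply, Functor.map_comp_apply]
            exact congrArg _ hc.symm
        change (φ.hom.app _).hom s = (H.obj.map (tensorMap j j)).hom t
        rw [map_mul, map_mul]
        refine congrArg₂ (· * ·) ((hn _).trans ?_) ((hn _).trans ?_)
        · rw [← tensorInl_map j j, Functor.map_comp_apply]
        · rw [← tensorInr_map j j, Functor.map_comp_apply]
      rw [← hs]
      exact app_mem_diffImage _ _
    -- Specialize the two generic factors to `x` and `y` simultaneously.
    have h := (diffImage (toVarietyHom φ)).map (tensorLift ψ χ) ht
    have e : (H.obj.map (tensorLift ψ χ)).hom t = H.obj.map ψ c * H.obj.map χ c := by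
      rw [map_mul]
      refine congrArg₂ (· * ·) ((Functor.map_comp_apply ..).symm.trans ?_)
        ((Functor.map_comp_apply ..).symm.trans ?_)
      · rw [tensorInl_lift]
      · rw [tensorInr_lift]
    exact Set.mem_of_eq_of_mem e.symm h
  inv_mem' {x} hx := by
    obtain ⟨C, B, j, c, b, hj, hc, hC⟩ :=
      exists_generic_diffImage G.property H.property (toVarietyHom φ)
    obtain ⟨ψ, rfl⟩ := hC R x hx
    let t : H.obj.obj C := (show H.obj.obj C from c)⁻¹
    have ht : t ∈ (diffImage (toVarietyHom φ)).obj C := by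
      refine (isDiffClosed_diffImage _).mem_of_injective j hj ?_
      have hs : (toVarietyHom φ).app B (show G.obj.obj B from b)⁻¹ = H.toVariety.map j t :=
        (map_inv (φ.hom.app B).hom b).trans
          ((congrArg (fun y : H.obj.obj B => y⁻¹) hc.symm).trans (map_inv (H.obj.map j).hom c).symm)
      rw [← hs]
      exact app_mem_diffImage _ _
    exact Set.mem_of_eq_of_mem (map_inv (H.obj.map ψ).hom c).symm
      ((diffImage (toVarietyHom φ)).map ψ ht)

/-- The image of a morphism of difference algebraic groups, as a difference algebraic group. -/
def image {G H : DiffAlgGroup σ} (φ : G ⟶ H) : DiffAlgGroup σ where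
  obj :=
    { obj R := GrpCat.of (imageSubgroup φ R)
      map {R S} ψ := GrpCat.ofHom (((H.obj.map ψ).hom.comp (imageSubgroup φ R).subtype).codRestrict
        (imageSubgroup φ S) fun x => (diffImage (toVarietyHom φ)).map ψ x.2)
      map_id R := by
        refine ConcreteCategory.hom_ext _ _ fun x => ?_
        exact Subtype.ext (Functor.map_id_apply H.obj R x.1)
      map_comp ψ χ := by
        refine ConcreteCategory.hom_ext _ _ fun x => ?_
        exact Subtype.ext (Functor.map_comp_apply H.obj ψ χ x.1) }
  property := H.property.toFunctor (isDiffClosed_diffImage (toVarietyHom φ))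

/-- The morphism onto the image. -/
def toImage {G H : DiffAlgGroup σ} (φ : G ⟶ H) : G ⟶ image φ :=
  ObjectProperty.homMk
    { app R := GrpCat.ofHom ((φ.hom.app R).hom.codRestrict (imageSubgroup φ R) fun x =>
        app_mem_diffImage (toVarietyHom φ) x)
      naturality R S ψ := by
        ext x
        exact Subtype.ext (NatTrans.naturality_apply φ.hom ψ x) }

/-- The inclusion of the image. -/
def imageι {G H : DiffAlgGroup σ} (φ : G ⟶ H) : image φ ⟶ H :=
  ObjectProperty.homMk
    { app R := GrpCat.ofHom (imageSubgroup φ R).subtype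
      naturality _ _ _ := rfl }

theorem toImage_imageι {G H : DiffAlgGroup σ} (φ : G ⟶ H) : toImage φ ≫ imageι φ = φ := rfl

theorem isClosedEmbedding_imageι {G H : DiffAlgGroup σ} (φ : G ⟶ H) :
    IsClosedEmbedding (imageι φ) :=
  ⟨diffImage (toVarietyHom φ), isDiffClosed_diffImage _, Iso.refl _, rfl⟩

/-- The generic point, viewed in `image φ`, lies in the image of `toImage φ`, since this can be
tested over `B`; all other points are its specializations. -/
theorem isQuotientMap_toImage {G H : DiffAlgGroup σ} (φ : G ⟶ H) : IsQuotientMap (toImage φ) := by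
  obtain ⟨C, B, j, c, b, hj, hc, hC⟩ :=
    exists_generic_diffImage G.property H.property (toVarietyHom φ)
  have hcZ : c ∈ (diffImage (toVarietyHom φ)).obj C :=
    (isDiffClosed_diffImage _).mem_of_injective j hj (hc ▸ app_mem_diffImage _ b)
  let c' : (image φ).toVariety.obj C := ⟨c, hcZ⟩
  have hc' : c' ∈ (diffImage (toVarietyHom (toImage φ))).obj C := by
    refine (isDiffClosed_diffImage _).mem_of_injective j hj ?_
    rw [show (image φ).toVariety.map j c' = (toVarietyHom (toImage φ)).app B b from Subtype.ext hc]
    exact app_mem_diffImage _ b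
  refine top_le_iff.1 fun R x _ => ?_
  obtain ⟨ψ, hψ⟩ := hC R x.1 x.2
  rw [show x = (image φ).toVariety.map ψ c' from Subtype.ext hψ.symm]
  exact (diffImage (toVarietyHom (toImage φ))).map ψ hc'

/-! ### Closed embeddings and uniqueness -/

theorem IsClosedEmbedding.isDiffClosed_range {G H : DiffAlgGroup σ} {ι : G ⟶ H}
    (hι : IsClosedEmbedding ι) : IsDiffClosed (Subfunctor.range (toVarietyHom ι)) := by
  obtain ⟨Z, hZ, e, he⟩ := hι
  rw [← he, Subfunctor.range_comp, Subfunctor.range_eq_top, Subfunctor.image_top,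
    Subfunctor.range_ι]
  exact hZ

theorem IsClosedEmbedding.injective {G H : DiffAlgGroup σ} {ι : G ⟶ H} (hι : IsClosedEmbedding ι)
    (R : DiffAlg σ) : Function.Injective (ι.hom.app R) := by
  obtain ⟨Z, -, e, he⟩ := hι
  have h : ∀ x : G.toVariety.obj R, ι.hom.app R x = (e.hom.app R x).1 := fun x =>
    (ConcreteCategory.congr_hom (NatTrans.congr_app he R) x).symm
  intro x y hxy
  have hxy' : (e.hom.app R x).1 = (e.hom.app R y).1 := by rw [← h, ← h]; exact hxy
  have := congrArg (e.inv.app R) (Subtype.ext hxy')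
  rwa [Iso.hom_inv_id_app_apply, Iso.hom_inv_id_app_apply] at this

theorem hom_ext {G H : DiffAlgGroup σ} {φ ψ : G ⟶ H}
    (h : ∀ R (x : G.obj.obj R), φ.hom.app R x = ψ.hom.app R x) : φ = ψ :=
  ObjectProperty.hom_ext _ (NatTrans.ext (funext fun R => ConcreteCategory.hom_ext _ _ (h R)))

theorem comp_app_apply {G H K : DiffAlgGroup σ} (φ : G ⟶ H) (ψ : H ⟶ K) (R : DiffAlg σ)
    (x : G.obj.obj R) : (φ ≫ ψ).hom.app R x = ψ.hom.app R (φ.hom.app R x) := rfl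

theorem IsClosedEmbedding.mono {G H : DiffAlgGroup σ} {ι : G ⟶ H} (hι : IsClosedEmbedding ι) :
    Mono ι where
  right_cancellation φ ψ h := hom_ext fun R x => hι.injective R (by
    rw [← comp_app_apply, ← comp_app_apply, h])

/-- The range of the closed embedding in a factorization is the image. -/
theorem range_eq_diffImage {G H K : DiffAlgGroup σ} {π : G ⟶ K} {ι : K ⟶ H}
    (hπ : IsQuotientMap π) (hι : IsClosedEmbedding ι) :
    Subfunctor.range (toVarietyHom ι) = diffImage (toVarietyHom (π ≫ ι)) := by
  refine le_antisymm ?_ (diffImage_le hι.isDiffClosed_range ?_)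
  -- The preimage of the image under `ι` is closed in `K` and contains the range of `π`, so it is
  -- all of `K`.
  · rw [← Subfunctor.preimage_eq_top_iff, ← top_le_iff, ← show diffImage (toVarietyHom π) = ⊤ from hπ]
    refine diffImage_le ((isDiffClosed_diffImage _).preimage _) ?_
    rintro R _ ⟨x, rfl⟩
    exact app_mem_diffImage (toVarietyHom (π ≫ ι)) x
  · rintro R _ ⟨x, rfl⟩
    exact ⟨π.hom.app R x, rfl⟩

/-- A morphism whose range is contained in that of a closed embedding factors through it. -/
theorem IsClosedEmbedding.exists_lift {G H K : DiffAlgGroup σ} {ι : K ⟶ H}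
    (hι : IsClosedEmbedding ι) (φ : G ⟶ H)
    (h : Subfunctor.range (toVarietyHom φ) ≤ Subfunctor.range (toVarietyHom ι)) :
    ∃ e : G ⟶ K, e ≫ ι = φ := by
  choose e he using fun (R : DiffAlg σ) (x : G.obj.obj R) =>
    show ∃ y : K.obj.obj R, (ι.hom.app R).hom y = (φ.hom.app R).hom x from h R ⟨x, rfl⟩
  -- Injectivity of `ι` makes the pointwise choices multiplicative and natural.
  have hinj : ∀ R, Function.Injective (ι.hom.app R).hom := hι.injective
  refine ⟨ObjectProperty.homMk
    { app R := GrpCat.ofHom (MonoidHom.mk' (e R) fun x y => hinj R ?_)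
      naturality R S ψ := ?_ }, hom_ext he⟩
  · rw [map_mul, he, he, he, map_mul]
  · ext x
    refine hinj S ((he S _).trans ?_)
    refine (NatTrans.naturality_apply φ.hom ψ x).trans ?_
    refine .trans ?_ (NatTrans.naturality_apply ι.hom ψ (e R x)).symm
    exact congrArg (H.obj.map ψ) (he R x).symm

end DiffAlgGroup

end

theorem mainTheorem6 {k : Type u} [Field k] (σ : k →+* k) (G H : DiffAlgGroup σ) (φ : G ⟶ H) :
    (∃ (H₁ : DiffAlgGroup σ) (π : G ⟶ H₁) (ι : H₁ ⟶ H),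
      DiffAlgGroup.IsQuotientMap π ∧ DiffAlgGroup.IsClosedEmbedding ι ∧ π ≫ ι = φ) ∧
    (∀ (H₁ H₂ : DiffAlgGroup σ) (π₁ : G ⟶ H₁) (ι₁ : H₁ ⟶ H) (π₂ : G ⟶ H₂) (ι₂ : H₂ ⟶ H),
      DiffAlgGroup.IsQuotientMap π₁ → DiffAlgGroup.IsClosedEmbedding ι₁ → π₁ ≫ ι₁ = φ →
      DiffAlgGroup.IsQuotientMap π₂ → DiffAlgGroup.IsClosedEmbedding ι₂ → π₂ ≫ ι₂ = φ →
      ∃! e : H₁ ≅ H₂, π₁ ≫ e.hom = π₂ ∧ e.hom ≫ ι₂ = ι₁) := by 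
  refine ⟨⟨_, DiffAlgGroup.toImage φ, DiffAlgGroup.imageι φ, DiffAlgGroup.isQuotientMap_toImage φ,
    DiffAlgGroup.isClosedEmbedding_imageι φ, DiffAlgGroup.toImage_imageι φ⟩, ?_⟩
  intro H₁ H₂ π₁ ι₁ π₂ ι₂ hπ₁ hι₁ h₁ hπ₂ hι₂ h₂
  have hr : Subfunctor.range (DiffAlgGroup.toVarietyHom ι₁) =
      Subfunctor.range (DiffAlgGroup.toVarietyHom ι₂) := by
    rw [DiffAlgGroup.range_eq_diffImage hπ₁ hι₁, DiffAlgGroup.range_eq_diffImage hπ₂ hι₂, h₁, h₂]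
  obtain ⟨e, he⟩ := hι₂.exists_lift ι₁ hr.le
  obtain ⟨e', he'⟩ := hι₁.exists_lift ι₂ hr.ge
  have := hι₁.mono
  have := hι₂.mono
  refine ⟨⟨e, e', ?_, ?_⟩, ⟨?_, he⟩, fun f hf => Iso.ext ?_⟩
  · rw [← cancel_mono ι₁, Category.assoc, he', he, Category.id_comp]
  · rw [← cancel_mono ι₂, Category.assoc, he, he', Category.id_comp]
  · rw [← cancel_mono ι₂, Category.assoc, he, h₁, h₂]
  · rw [← cancel_mono ι₂, hf.2, he]
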